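/- Let $\mathrm{GF}(q)\subseteq \mathrm{GF}(q^m)$ be finite fields, let $N=q^m-1$, and let $\{\beta_1,\dots,\beta_m\}$ be a basis of $\mathrm{GF}(q^m)$ over $\mathrm{GF}(q)$. For $x\in\mathrm{GF}(q^m)$ write $x=\sum_{j=1}^m\mu_j(x)\beta_j$ with $\mu_j(x)\in\mathrm{GF}(q)$. For a finite family $\Gamma$ of nonzero elements of $\mathrm{GF}(q^m)$ let ${\bf G}_e(\Gamma)$ be the expanded generator matrix: it has a row for each pair $(\gamma,i)$ with $\gamma$ in $\Gamma$ and $1\le i\le m$, namely the vector $\beta_i\,[1,\gamma,\gamma^2,\dots,\gamma^{N-1}]$ with each entry $x$ replaced by $(\mu_1(x),\dots,\mu_m(x))$. The expanded code of $\Gamma$ is the row space of ${\bf G}_e(\Gamma)$ over $\mathrm{GF}(q)$, a linear code of length $mN$ over $\mathrm{GF}(q)$. A codeword is represented by the subbasis $\{\beta_j: j\in S\}$, $S\subseteq\{1,\dots,m\}$, if all its coordinates belonging to $\beta_j$ with $j\notin S$ vanish. For $\gamma\in\mathrm{GF}(q^m)$ let $\phi(\gamma)=\{\gamma,\gamma^q,\gamma^{q^2},\dots\}$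 be its conjugacy class and $p_\gamma(x)\in\mathrm{GF}(q)[x]$ its minimal polynomial over $\mathrm{GF}(q)$. The minimum distance of a code is the least Hamming distance between two distinct codewords, and $+\infty$ for a code with only one codeword. Theorem. Let $\gamma_1,\dots,\gamma_k$ be nonzero elements of $\mathrm{GF}(q^m)$. Then the minimum distance $d_{\min}$ of the expanded code with generator matrix ${\bf G}_e(\gamma_1,\dots,\gamma_k)$ satisfies $$d_{\min}\;\ge\;\min_{1\le i\le m}\{\,i\cdot d^{(i)}\,\},$$ where $d^{(i)}$ is the minimum distance of the cyclic code of length $N$ over $\mathrm{GF}(q)$ with generator polynomial $$G^{(i)}(x)=\frac{x^N-1}{\operatorname{LCM}\{p_{\gamma_l^{-1}}(x):\ l\in J_i\}}$$ and $J_i$ is the set of those $l\in\{1,\dots,k\}$ for which the expanded code of $\phi(\gamma_l)\cap\{\gamma_1,\dots,\gamma_k\}$ contains a nonzero codeword that is represented by a subbasis of at most $i$ elements. (The LCM of the empty set is $1$.) -/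

import Mathlib

open Polynomial

/-- The minimum distance of a code `C`: the least Hamming distance between two distinct
codewords, with the value `⊤` if there are no two distinct codewords. -/
noncomputable def minDist {ι K : Type*} [Fintype ι] (C : Set (ι → K)) : ℕ∞ :=
  open Classical in
  ⨅ (x ∈ C) (y ∈ C) (_ : x ≠ y), ((hammingDist x y : ℕ) : ℕ∞)

/-- The conjugacy class `{γ, γ^q, γ^(q^2), …}` of `γ` over `K = GF(q)`. -/
def conjClass (K : Type*) {L : Type*} [Fintype K] [Field L] (γ : L) : Set L :=
  Set.range fun s : ℕ => γ ^ (Fintype.card K ^ s)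

/-- The row vector `[1, γ, γ^2, …, γ^(N-1)]`. -/
def gVec {L : Type*} [Field L] (N : ℕ) (γ : L) : Fin N → L := fun t => γ ^ (t : ℕ)

/-- The expanded generator matrix of the family `γ` with respect to the basis `β`. The row
`(l, i)` is the vector `β_i • g(γ_l)`, every entry of which is replaced by its `m` coordinates
over `K`: the entry in column `(t, j)` is `μ_j (β_i * γ_l ^ t)`. -/
noncomputable def expandedGenMatrix {K L ι : Type*} [Field K] [Field L] [Algebra K L] {m : ℕ}
    (β : Module.Basis (Fin m) K L) (N : ℕ) (γ : ι → L) :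
    Matrix (ι × Fin m) (Fin N × Fin m) K :=
  Matrix.of fun r c => β.repr (β r.2 * gVec N (γ r.1) c.1) c.2

/-- The expanded code: the row space over `K` of the expanded generator matrix. -/
noncomputable def expandedCode {K L ι : Type*} [Field K] [Field L] [Algebra K L] {m : ℕ}
    (β : Module.Basis (Fin m) K L) (N : ℕ) (γ : ι → L) : Submodule K (Fin N × Fin m → K) :=
  Submodule.span K (Set.range (expandedGenMatrix β N γ).row)

/-- A word is represented by the subbasis `{β_j : j ∈ S}` if its components with respect to all
other basis elements vanish. -/
def RepresentedBySubbasis {K : Type*} [Field K] {N m : ℕ} (S : Finset (Fin m))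
    (c : Fin N × Fin m → K) : Prop :=
  ∀ j, j ∉ S → ∀ t, c (t, j) = 0

/-- Some nonzero codeword of the expanded code of the family `γ` is represented by a subbasis
with at most `i` elements. -/
def HasSubbasisCodeword {K L ι : Type*} [Field K] [Field L] [Algebra K L] {m : ℕ}
    (β : Module.Basis (Fin m) K L) (N : ℕ) (γ : ι → L) (i : ℕ) : Prop :=
  ∃ c ∈ expandedCode β N γ, c ≠ 0 ∧
    ∃ S : Finset (Fin m), S.card ≤ i ∧ RepresentedBySubbasis S c

/-- The polynomial `(x^N - 1) / LCM {p_{γ_l⁻¹} : l}`, where `l` runs over those indices for which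
the expanded code of the part `φ(γ_l) ∩ {γ_1, …, γ_k}` has a nonzero codeword on a subbasis with
at most `i` elements. -/
noncomputable def subbasisGenPoly {K L : Type*} [Field K] [Fintype K] [Field L] [Algebra K L]
    {m k : ℕ} (β : Module.Basis (Fin m) K L) (N : ℕ) (γ : Fin k → L) (i : ℕ) : K[X] :=
  open Classical in
  (X ^ N - 1) /
    (Finset.univ.filter fun l : Fin k =>
      HasSubbasisCodeword β N
        (fun x : ↥(conjClass K (γ l) ∩ Set.range γ) => (x : L)) i).lcm
      fun l => minpoly K (γ l)⁻¹

/-- The cyclic code of length `N` with generator polynomial `G` (a divisor of `x^N - 1`): the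
words `c` for which `G` divides `c_0 + c_1 x + ⋯ + c_{N-1} x^(N-1)`. -/
def cyclicCode {K : Type*} [Field K] (N : ℕ) (G : K[X]) : Set (Fin N → K) :=
  {c | G ∣ ∑ t : Fin N, C (c t) * X ^ (t : ℕ)}

/-!
The expanded code is invariant under the simultaneous cyclic shift `T` of the components of a word:
`T` sends the word of `a [1, γ, γ^2, …]` to that of `a γ⁻¹ [1, γ, γ^2, …]`, so `P(T)` multiplies
the coefficient `a` by `P(γ⁻¹)`. Let `c` be a codeword whose nonzero components are indexed by `S`.
If `l` does not belong to `J_i` for `i = |S|`, then the product of the `p_{γ⁻¹}` over the `γ` not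
conjugate to `γ_l` carries `c` into the expanded code of the conjugates of `γ_l`, without enlarging
`S`, and hence to `0`; this product is coprime to `p_{γ_l⁻¹}`. So the factors `p_{γ_l⁻¹}` with `l`
outside `J_i` may be cancelled from any polynomial annihilating `c`, and `c` is annihilated by the
least common multiple of those with `l` in `J_i`. This says that each component lies in the cyclic
code generated by `G^(i)`, and the `i` nonzero components contribute at least `i * d^(i)` to the
weight.
-/

section LinearMaps

theorem map_aeval_apply_of_map_apply {R V W : Type*} [CommSemiring R] [AddCommMonoid V]
    [Module R V] [AddCommMonoid W] [Module R W] {S : Module.End R V} {T : Module.End R W}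
    (f : V →ₗ[R] W) (hf : ∀ v, f (S v) = T (f v)) (P : R[X]) (v : V) :
    f (aeval S P v) = aeval T P (f v) := by
  induction P using Polynomial.induction_on' generalizing v with
  | add P Q hP hQ => simp only [map_add, LinearMap.add_apply, hP, hQ]
  | monomial n r =>
    have hpow : f ((S ^ n) v) = (T ^ n) (f v) := by
      induction n with
      | zero => rfl
      | succ n ih => rw [pow_succ', pow_succ', Module.End.mul_apply, Module.End.mul_apply, hf, ih]
    simp only [aeval_monomial, Module.End.mul_apply, Module.algebraMap_end_apply, map_smul, hpow]

theorem aeval_apply_eq_zero_of_mul_prod {R V ι : Type*} [CommRing R] [AddCommGroup V]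
    [Module R V] {T : Module.End R V} {v : V} {Q : R[X]} {p : ι → R[X]} {s : Finset ι}
    (hprod : aeval T (Q * ∏ i ∈ s, p i) v = 0)
    (hcoprime : ∀ i ∈ s, ∃ r, IsCoprime (p i) r ∧ aeval T r v = 0) : aeval T Q v = 0 := by
  classical
  induction s using Finset.induction_on with
  | empty => simpa using hprod
  | insert i s his ih =>
    obtain ⟨r, hr, hrv⟩ := hcoprime i (Finset.mem_insert_self i s)
    refine ih ?_ fun j hj => hcoprime j (Finset.mem_insert_of_mem hj)
    refine Submodule.disjoint_def.1 (disjoint_ker_aeval_of_isCoprime T hr) _ ?_ ?_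
    · rwa [LinearMap.mem_ker, ← Module.End.mul_apply, ← map_mul, mul_left_comm,
        ← Finset.prod_insert his]
    · rw [LinearMap.mem_ker, ← Module.End.mul_apply, ← map_mul, mul_comm, map_mul,
        Module.End.mul_apply, hrv, map_zero]

end LinearMaps

section ConjugateRoots

variable {K L : Type*} [Field K] [Field L] [Algebra K L]

theorem isCoprime_minpoly_of_not_isConjRoot {x y : L} (hx : IsIntegral K x) (hy : IsIntegral K y)
    (h : ¬ IsConjRoot K x y) : IsCoprime (minpoly K x) (minpoly K y) :=
  (minpoly.irreducible hx).coprime_iff_not_dvd.2 fun hdvd => h <|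
    eq_of_monic_of_associated (minpoly.monic hx) (minpoly.monic hy) <|
      (minpoly.irreducible hx).associated_of_dvd (minpoly.irreducible hy) hdvd

theorem isConjRoot_inv [Normal K L] {x y : L} (h : IsConjRoot K x y) :
    IsConjRoot K x⁻¹ y⁻¹ := by
  obtain ⟨σ, rfl⟩ := isConjRoot_iff_exists_algEquiv.1 h
  rw [← map_inv₀]
  exact isConjRoot_of_algEquiv' _ _

theorem mem_conjClass_of_isConjRoot [Fintype K] [Finite L] {x y : L} (h : IsConjRoot K x y) :
    y ∈ conjClass K x := by
  obtain ⟨σ, rfl⟩ := isConjRoot_iff_exists_algEquiv.1 h.symm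
  obtain ⟨s, rfl⟩ := (FiniteField.bijective_frobeniusAlgEquivOfAlgebraic_pow K L).2 σ
  exact ⟨s, by simp [AlgEquiv.coe_pow, FiniteField.coe_frobeniusAlgEquivOfAlgebraic_iterate]⟩

theorem pow_card_pow_sub_one_eq_one [Fintype K] {m : ℕ} (β : Module.Basis (Fin m) K L) {x : L}
    (hx : x ≠ 0) : x ^ (Fintype.card K ^ m - 1) = 1 := by
  let _ : Fintype L := Module.fintypeOfFintype β
  have hcard : Fintype.card L = Fintype.card K ^ m := by
    rw [Module.card_fintype β, Fintype.card_fin]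
  rw [← hcard, FiniteField.pow_card_sub_one_eq_one x hx]

end ConjugateRoots

section CyclicShift

variable {R K : Type*} [CommRing R] [Field K] {N : ℕ}

/-- The cyclic shift `(u_0, …, u_{N-1}) ↦ (u_{N-1}, u_0, …, u_{N-2})`, which is multiplication by
`x` in `K[x] / (x^N - 1)`. -/
def cyclicShift (R : Type*) [CommRing R] (N : ℕ) : Module.End R (Fin N → R) :=
  LinearMap.funLeft R R (finRotate N).symm

/-- The polynomial `u_0 + u_1 x + ⋯ + u_{N-1} x^(N-1)` of a word `u`. -/
noncomputable def wordPoly : (Fin N → R) →ₗ[R] R[X] :=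
  Fintype.linearCombination R fun t : Fin N => X ^ (t : ℕ)

theorem pow_finRotate {M : Type*} [Monoid M] {x : M} (hx : x ^ N = 1) (t : Fin N) :
    x ^ (finRotate N t : ℕ) = x * x ^ (t : ℕ) := by
  obtain _ | n := N
  · exact t.elim0
  rw [coe_finRotate, ← pow_succ']
  split_ifs with ht
  · rw [ht, Fin.val_last, hx, pow_zero]
  · rfl

theorem aeval_wordPoly_cyclicShift {A : Type*} [Ring A] [Algebra R A] {x : A} (hx : x ^ N = 1)
    (u : Fin N → R) : aeval x (wordPoly (cyclicShift R N u)) = x * aeval x (wordPoly u) := by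
  simp only [wordPoly, Fintype.linearCombination_apply, map_sum, map_smul, map_pow, aeval_X,
    Finset.mul_sum, mul_smul_comm, ← pow_finRotate hx]
  refine Fintype.sum_equiv (finRotate N).symm _ _ fun t => ?_
  rw [cyclicShift, LinearMap.funLeft_apply, Equiv.apply_symm_apply]

theorem aeval_wordPoly_aeval_cyclicShift {A : Type*} [Ring A] [Algebra R A] {x : A}
    (hx : x ^ N = 1) (P : R[X]) (u : Fin N → R) :
    aeval x (wordPoly (aeval (cyclicShift R N) P u)) = aeval x P * aeval x (wordPoly u) := by
  have h := map_aeval_apply_of_map_apply (T := Algebra.lmul R A x)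
    ((aeval x).toLinearMap ∘ₗ wordPoly) (aeval_wordPoly_cyclicShift hx) P u
  rwa [aeval_algHom_apply] at h

theorem X_pow_sub_one_dvd_mul_wordPoly {P : R[X]} {u : Fin N → R}
    (h : aeval (cyclicShift R N) P u = 0) : X ^ N - 1 ∣ P * wordPoly u := by
  have hroot : AdjoinRoot.root (X ^ N - 1 : R[X]) ^ N = 1 := by
    rw [← sub_eq_zero, ← AdjoinRoot.mk_X, ← map_pow, ← map_one (AdjoinRoot.mk _), ← map_sub,
      AdjoinRoot.mk_self]
  rw [← AdjoinRoot.mk_eq_zero, ← AdjoinRoot.aeval_eq, map_mul,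
    ← aeval_wordPoly_aeval_cyclicShift hroot, h, map_zero, map_zero]

theorem mem_cyclicCode_iff {G : K[X]} {u : Fin N → K} : u ∈ cyclicCode N G ↔ G ∣ wordPoly u := by
  simp only [cyclicCode, Set.mem_ofPred_eq, wordPoly, Fintype.linearCombination_apply,
    smul_eq_C_mul]

theorem mem_cyclicCode_div_of_aeval_cyclicShift_eq_zero {P : K[X]} {u : Fin N → K} (hP0 : P ≠ 0)
    (hP : P ∣ X ^ N - 1) (h : aeval (cyclicShift K N) P u = 0) :
    u ∈ cyclicCode N ((X ^ N - 1) / P) := by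
  have hdvd := X_pow_sub_one_dvd_mul_wordPoly h
  rw [← EuclideanDomain.mul_div_cancel' hP0 hP] at hdvd
  exact mem_cyclicCode_iff.2 ((mul_dvd_mul_iff_left hP0).1 hdvd)

end CyclicShift

section MinDist

variable {R τ : Type*} [DecidableEq R] [Fintype τ]

theorem minDist_le_hammingNorm [Zero R] {C : Set (τ → R)} (h0 : 0 ∈ C) {u : τ → R} (hu : u ∈ C)
    (hu0 : u ≠ 0) : minDist C ≤ hammingNorm u := by
  refine (iInf₂_le u hu).trans ((iInf₂_le 0 h0).trans ((iInf_le _ hu0).trans_eq ?_))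
  rw [← hammingDist_zero_right]
  congr!

theorem le_minDist_of_forall_le_hammingNorm [Ring R] {C : Submodule R (τ → R)} {d : ℕ∞}
    (h : ∀ c ∈ C, c ≠ 0 → d ≤ hammingNorm c) : d ≤ minDist (C : Set (τ → R)) := by
  refine le_iInf₂ fun x hx => le_iInf₂ fun y hy => le_iInf fun hxy => ?_
  refine (h (-x + y) (C.add_mem (C.neg_mem hx) hy) (mt neg_add_eq_zero.1 hxy)).trans_eq ?_
  rw [← hammingDist_eq_hammingNorm]
  congr!

end MinDist

section Components

variable {R τ κ : Type*} [CommRing R]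

/-- The word of coordinates of `c` belonging to the `j`-th basis element. -/
def component (j : κ) : (τ × κ → R) →ₗ[R] (τ → R) := LinearMap.funLeft R R fun t => (t, j)

theorem representedBySubbasis_iff {K : Type*} [Field K] {N m : ℕ} {S : Finset (Fin m)}
    {c : Fin N × Fin m → K} : RepresentedBySubbasis S c ↔ ∀ j ∉ S, component j c = 0 :=
  forall₂_congr fun _ _ => funext_iff.symm

/-- The simultaneous cyclic shift of all components of a word. -/
def quasicyclicShift (R : Type*) [CommRing R] (N : ℕ) (κ : Type*) :
    Module.End R (Fin N × κ → R) :=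
  LinearMap.funLeft R R (Prod.map (finRotate N).symm id)

theorem component_aeval_quasicyclicShift {N : ℕ} (j : κ) (P : R[X]) (c : Fin N × κ → R) :
    component j (aeval (quasicyclicShift R N κ) P c) =
      aeval (cyclicShift R N) P (component j c) :=
  map_aeval_apply_of_map_apply (S := quasicyclicShift R N κ) (T := cyclicShift R N) (component j)
    (fun _ => rfl) P c

theorem hammingNorm_eq_sum_component [DecidableEq R] [Fintype τ] [Fintype κ] (c : τ × κ → R) :
    hammingNorm c = ∑ j, hammingNorm (component j c) := by
  simp only [hammingNorm, Finset.card_filter, Fintype.sum_prod_type_right]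
  rfl

theorem card_mul_minDist_le_hammingNorm [DecidableEq R] [Fintype τ] [Fintype κ]
    {C : Set (τ → R)} (h0 : 0 ∈ C) {c : τ × κ → R} {S : Finset κ}
    (hC : ∀ j ∈ S, component j c ∈ C) (hS : ∀ j ∈ S, component j c ≠ 0) :
    S.card * minDist C ≤ hammingNorm c :=
  calc (S.card : ℕ∞) * minDist C
    _ = ∑ _j ∈ S, minDist C := by rw [Finset.sum_const, nsmul_eq_mul]
    _ ≤ ∑ j ∈ S, (hammingNorm (component j c) : ℕ∞) :=
      Finset.sum_le_sum fun j hj => minDist_le_hammingNorm h0 (hC j hj) (hS j hj)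
    _ ≤ ∑ j, (hammingNorm (component j c) : ℕ∞) :=
      Finset.sum_le_sum_of_subset (Finset.subset_univ S)
    _ = hammingNorm c := by rw [hammingNorm_eq_sum_component, Nat.cast_sum]

end Components

section ExpandedCode

variable {K L ι ι' : Type*} [Field K] [Field L] [Algebra K L] {m N : ℕ}
  (β : Module.Basis (Fin m) K L)

/-- The word of coordinates over `K` of the vector `a [1, γ, …, γ^(N-1)]`, as a function of `a`. -/
noncomputable def coordWord (N : ℕ) (γ : L) : L →ₗ[K] (Fin N × Fin m → K) :=
  LinearMap.pi fun c => β.coord c.2 ∘ₗ LinearMap.mulRight K (γ ^ (c.1 : ℕ))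

theorem expandedCode_eq_iSup_range_coordWord (γ : ι → L) :
    expandedCode β N γ = ⨆ l, LinearMap.range (coordWord β N (γ l)) := by
  have hrow : ∀ l, LinearMap.range (coordWord β N (γ l)) =
      Submodule.span K (Set.range fun i => (expandedGenMatrix β N γ).row (l, i)) := fun l => by
    rw [LinearMap.range_eq_map, ← β.span_eq, Submodule.map_span, ← Set.range_comp]
    rfl
  simp only [hrow, ← Submodule.span_iUnion]
  refine congrArg (Submodule.span K) (Set.ext fun w => ?_)
  simp only [Set.mem_iUnion, Set.mem_range, Prod.exists]

theorem coordWord_mul_inv {γ : L} (hγ : γ ^ N = 1) (a : L) :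
    coordWord β N γ (a * γ⁻¹) = quasicyclicShift K N (Fin m) (coordWord β N γ a) := by
  ext ⟨t, j⟩
  have hγ0 : γ ≠ 0 := (IsUnit.of_pow_eq_one hγ t.pos.ne').ne_zero
  have hpow : γ⁻¹ * γ ^ (t : ℕ) = γ ^ ((finRotate N).symm t : ℕ) := by
    rw [inv_mul_eq_iff_eq_mul₀ hγ0, ← pow_finRotate hγ, Equiv.apply_symm_apply]
  simp [coordWord, quasicyclicShift, mul_assoc, hpow]

theorem aeval_quasicyclicShift_coordWord {γ : L} (hγ : γ ^ N = 1) (P : K[X]) (a : L) :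
    aeval (quasicyclicShift K N (Fin m)) P (coordWord β N γ a) =
      coordWord β N γ (aeval γ⁻¹ P * a) := by
  have h := map_aeval_apply_of_map_apply (S := Algebra.lmul K L γ⁻¹) (coordWord β N γ)
    (fun a => by simpa [mul_comm] using coordWord_mul_inv β hγ a) P a
  rw [← h, aeval_algHom_apply]
  rfl

variable {β} {γ : ι → L} {c : Fin N × Fin m → K}

theorem aeval_quasicyclicShift_mem_expandedCode (hγ : ∀ l, γ l ^ N = 1) {δ : ι' → L} {P : K[X]}
    (hP : ∀ l, aeval (γ l)⁻¹ P ≠ 0 → γ l ∈ Set.range δ) (hc : c ∈ expandedCode β N γ) :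
    aeval (quasicyclicShift K N (Fin m)) P c ∈ expandedCode β N δ := by
  suffices hle : expandedCode β N γ ≤
      (expandedCode β N δ).comap (aeval (quasicyclicShift K N (Fin m)) P) from hle hc
  rw [expandedCode_eq_iSup_range_coordWord]
  refine iSup_le fun l => ?_
  rintro _ ⟨a, rfl⟩
  rw [Submodule.mem_comap, aeval_quasicyclicShift_coordWord β (hγ l)]
  by_cases hl : aeval (γ l)⁻¹ P = 0
  · rw [hl, zero_mul, map_zero]
    exact zero_mem _
  · obtain ⟨i, hi⟩ := hP l hl
    rw [expandedCode_eq_iSup_range_coordWord, ← hi]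
    exact Submodule.mem_iSup_of_mem i ⟨_, rfl⟩

theorem aeval_quasicyclicShift_eq_zero (hγ : ∀ l, γ l ^ N = 1) {P : K[X]}
    (hP : ∀ l, aeval (γ l)⁻¹ P = 0) (hc : c ∈ expandedCode β N γ) :
    aeval (quasicyclicShift K N (Fin m)) P c = 0 := by
  have hmem := aeval_quasicyclicShift_mem_expandedCode (δ := (Empty.elim : Empty → L)) hγ
    (fun l hl => absurd (hP l) hl) hc
  rwa [expandedCode_eq_iSup_range_coordWord, iSup_of_empty, Submodule.mem_bot] at hmem

theorem hasSubbasisCodeword_of_aeval_quasicyclicShift_ne_zero (hγ : ∀ l, γ l ^ N = 1)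
    {δ : ι' → L} {P : K[X]} (hP : ∀ l, aeval (γ l)⁻¹ P ≠ 0 → γ l ∈ Set.range δ)
    (hc : c ∈ expandedCode β N γ) {S : Finset (Fin m)} (hS : RepresentedBySubbasis S c)
    (hPc : aeval (quasicyclicShift K N (Fin m)) P c ≠ 0) :
    HasSubbasisCodeword β N δ S.card := by
  refine ⟨_, aeval_quasicyclicShift_mem_expandedCode hγ hP hc, hPc, S, le_rfl, ?_⟩
  rw [representedBySubbasis_iff] at hS ⊢
  exact fun j hj => by rw [component_aeval_quasicyclicShift, hS j hj, map_zero]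

end ExpandedCode

section SubbasisCode

variable {K L : Type*} [Field K] [Fintype K] [Field L] [Algebra K L] {m k N : ℕ}
  {β : Module.Basis (Fin m) K L} {γ : Fin k → L} {c : Fin N × Fin m → K} {S : Finset (Fin m)}

/-- The subfamily of the conjugates of `γ_l`, that is `φ(γ_l) ∩ {γ_1, …, γ_k}`; repeated elements
are listed once. -/
abbrev conjugateSubfamily (K : Type*) {L : Type*} [Fintype K] [Field L] {k : ℕ} (γ : Fin k → L)
    (l : Fin k) : ↥(conjClass K (γ l) ∩ Set.range γ) → L :=
  Subtype.val

theorem exists_isCoprime_minpoly_inv_aeval_eq_zero (hγ : ∀ l, γ l ^ N = 1)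
    (hc : c ∈ expandedCode β N γ) (hS : RepresentedBySubbasis S c) {l : Fin k}
    (hl : ¬ HasSubbasisCodeword β N (conjugateSubfamily K γ l) S.card) :
    ∃ r, IsCoprime (minpoly K (γ l)⁻¹) r ∧ aeval (quasicyclicShift K N (Fin m)) r c = 0 := by
  classical
  have : Module.Finite K L := .of_basis β
  have : Finite L := Module.finite_of_finite K
  refine ⟨∏ i with γ i ∉ conjClass K (γ l), minpoly K (γ i)⁻¹, ?_, ?_⟩
  · refine IsCoprime.prod_right fun i hi => isCoprime_minpoly_of_not_isConjRoot
      (.of_finite K _) (.of_finite K _) fun hconj => (Finset.mem_filter.1 hi).2 ?_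
    simpa using mem_conjClass_of_isConjRoot (isConjRoot_inv hconj)
  · contrapose! hl
    refine hasSubbasisCodeword_of_aeval_quasicyclicShift_ne_zero hγ (fun i hi => ?_) hc hS hl
    rw [Subtype.range_coe]
    refine ⟨by_contra fun hconj => hi ?_, i, rfl⟩
    rw [map_prod]
    exact Finset.prod_eq_zero (Finset.mem_filter.2 ⟨Finset.mem_univ i, hconj⟩) (minpoly.aeval K _)

theorem aeval_quasicyclicShift_eq_zero_of_minpoly_inv_dvd (hγ : ∀ l, γ l ^ N = 1)
    (hc : c ∈ expandedCode β N γ) (hS : RepresentedBySubbasis S c) {P : K[X]}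
    (hP : ∀ l, HasSubbasisCodeword β N (conjugateSubfamily K γ l) S.card →
      minpoly K (γ l)⁻¹ ∣ P) :
    aeval (quasicyclicShift K N (Fin m)) P c = 0 := by
  classical
  let s : Finset (Fin k) := {l | ¬ HasSubbasisCodeword β N (conjugateSubfamily K γ l) S.card}
  refine aeval_apply_eq_zero_of_mul_prod (p := fun l => minpoly K (γ l)⁻¹) (s := s) ?_
    fun l hl => exists_isCoprime_minpoly_inv_aeval_eq_zero hγ hc hS (Finset.mem_filter.1 hl).2
  refine aeval_quasicyclicShift_eq_zero hγ (fun l => ?_) hc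
  refine aeval_eq_zero_of_dvd_aeval_eq_zero ?_ (minpoly.aeval K (γ l)⁻¹)
  by_cases hl : l ∈ s
  · exact (Finset.dvd_prod_of_mem _ hl).mul_left _
  · exact (hP l (by simpa [s] using hl)).mul_right _

theorem component_mem_cyclicCode_subbasisGenPoly (hγ : ∀ l, γ l ^ N = 1)
    (hc : c ∈ expandedCode β N γ) (hS : RepresentedBySubbasis S c) (j : Fin m) :
    component j c ∈ cyclicCode N (subbasisGenPoly β N γ S.card) := by
  classical
  have : Module.Finite K L := .of_basis β
  refine mem_cyclicCode_div_of_aeval_cyclicShift_eq_zero ?_ ?_ ?_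
  · rw [Ne, Finset.lcm_eq_zero_iff]
    rintro ⟨l, -, hl⟩
    exact minpoly.ne_zero (.of_finite K _) hl
  · exact Finset.lcm_dvd fun l _ => minpoly.dvd K _ (by simp [hγ l])
  · rw [← component_aeval_quasicyclicShift,
      aeval_quasicyclicShift_eq_zero_of_minpoly_inv_dvd hγ hc hS fun l hl => ?_, map_zero]
    exact Finset.dvd_lcm (f := fun l => minpoly K (γ l)⁻¹)
      (Finset.mem_filter.2 ⟨Finset.mem_univ l, hl⟩)

end SubbasisCode

theorem mainTheorem5_general {K L : Type*} [Field K] [Fintype K] [Field L] [Algebra K L]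
    (m k : ℕ) (β : Module.Basis (Fin m) K L) (γ : Fin k → L) (N : ℕ) (hγ : ∀ l, γ l ^ N = 1) :
    (⨅ i ∈ Finset.Icc 1 m, (i : ℕ∞) * minDist (cyclicCode N (subbasisGenPoly β N γ i))) ≤
      minDist (expandedCode β N γ : Set (Fin N × Fin m → K)) := by
  classical
  refine le_minDist_of_forall_le_hammingNorm fun c hc hc0 => ?_
  let S : Finset (Fin m) := {j | component j c ≠ 0}
  have hS : RepresentedBySubbasis S c := representedBySubbasis_iff.2 fun j hj => by
    simpa [S] using hj
  have hS_nonempty : S.Nonempty := Finset.nonempty_iff_ne_empty.2 fun hempty =>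
    hc0 (funext fun ⟨t, j⟩ => hS j (by simp [hempty]) t)
  have hS_card : S.card ∈ Finset.Icc 1 m :=
    Finset.mem_Icc.2 ⟨hS_nonempty.card_pos, card_finset_fin_le S⟩
  refine (iInf₂_le S.card hS_card).trans (card_mul_minDist_le_hammingNorm ?_
    (fun j _ => component_mem_cyclicCode_subbasisGenPoly hγ hc hS j)
    fun j hj => (Finset.mem_filter.1 hj).2)
  simp [mem_cyclicCode_iff]

theorem mainTheorem5 {K L : Type*} [Field K] [Fintype K] [Field L] [Algebra K L]
    (m k : ℕ) (β : Module.Basis (Fin m) K L)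
    (γ : Fin k → L) (hγ : ∀ l, γ l ≠ 0)
    (N : ℕ) (hN : N = Fintype.card K ^ m - 1) :
    (⨅ i ∈ Finset.Icc 1 m, (i : ℕ∞) * minDist (cyclicCode N (subbasisGenPoly β N γ i))) ≤
      minDist (expandedCode β N γ : Set (Fin N × Fin m → K)) :=
  mainTheorem5_general m k β γ N fun l => hN ▸ pow_card_pow_sub_one_eq_one β (hγ l)
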